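/- There are universal constants $c>0$ and $p\in\mathbb{N}$ such that the following holds. Let $d,n,k$ be natural numbers, $0<\delta\le 1$, $0<\eta<1$, and put $$C \;=\; c\,\bigl(1+\log d+\log n+\log(1/\eta)\bigr)^p$$ (with $\log 0$ read as $0$). Let $\boldsymbol{x}_1,\dots,\boldsymbol{x}_n$ be independent standard Gaussian vectors in $\mathbb{R}^d$, and let $M$ be a symmetric $d\times d$ real matrix of rank at most $k$, which is either fixed or, more generally, random and independent of $(\boldsymbol{x}_1,\dots,\boldsymbol{x}_n)$. Let $\mathcal{A}$ be the symmetric rank-one sensing operator $\mathcal{A}(M)=(\boldsymbol{x}_i^\top M\boldsymbol{x}_i)_{i=1}^n\in\mathbb{R}^n$ and $\mathcal{A}'$ its adjoint $\mathcal{A}'(y)=\sum_{i=1}^n y_i\,\boldsymbol{x}_i\boldsymbol{x}_i^\top$. If $$n \;\ge\; C\,\frac{k^3 d}{\delta^2},$$ then with probability at least $1-\eta$, $$\Bigl\|\tfrac{1}{2n}\mathcal{A}'\mathcal{A}(M)-\tfrac12\operatorname{tr}(M)\,I-M\Bigr\|_2\;\le\;\delta\,\|M\|_2,$$ where $\|\cdot\|_2$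 is the spectral norm. -/

import Mathlib

open MeasureTheory ProbabilityTheory
-- Norms of real matrices are spectral norms (operator norms for the Euclidean norm).
open scoped Matrix Matrix.Norms.L2Operator

/-- The symmetric rank-one sensing operator `𝒜` with design vectors `x₁, …, xₙ ∈ ℝᵈ`:
`𝒜(M) = (⟨xᵢ xᵢᵀ, M⟩)ᵢ = (xᵢᵀ M xᵢ)ᵢ`. -/
noncomputable def sensingOp {n d : ℕ} (x : Fin n → EuclideanSpace ℝ (Fin d))
    (M : Matrix (Fin d) (Fin d) ℝ) : Fin n → ℝ :=
  fun i => (x i).ofLp ⬝ᵥ (M *ᵥ (x i).ofLp)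

/-- The adjoint `𝒜'` of the sensing operator: `𝒜'(y) = ∑ᵢ yᵢ xᵢ xᵢᵀ`. -/
noncomputable def sensingAdj {n d : ℕ} (x : Fin n → EuclideanSpace ℝ (Fin d))
    (y : Fin n → ℝ) : Matrix (Fin d) (Fin d) ℝ :=
  ∑ i, y i • Matrix.vecMulVec (x i).ofLp (x i).ofLp

/-- `sensingAdj x` is the adjoint of `sensingOp x` for the Frobenius inner product
`⟨A, B⟩ = tr(Aᵀ B)` on matrices and the dot product on `ℝⁿ`. -/
theorem sensingOp_dotProduct {n d : ℕ} (x : Fin n → EuclideanSpace ℝ (Fin d))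
    (M : Matrix (Fin d) (Fin d) ℝ) (y : Fin n → ℝ) :
    sensingOp x M ⬝ᵥ y = (Mᵀ * sensingAdj x y).trace := by
  simp only [sensingOp, sensingAdj, dotProduct, Matrix.mulVec, Matrix.trace, Matrix.diag,
    Matrix.mul_apply, Matrix.transpose_apply, Matrix.sum_apply, Matrix.smul_apply,
    Matrix.vecMulVec_apply, smul_eq_mul, Finset.mul_sum, Finset.sum_mul]
  -- all sums in the order: design vector, row, column
  conv_rhs => rw [Finset.sum_comm]
  conv_rhs => enter [2, a]; rw [Finset.sum_comm]
  conv_rhs => rw [Finset.sum_comm]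
  refine Finset.sum_congr rfl fun i _ => Finset.sum_congr rfl fun a _ => ?_
  exact Finset.sum_congr rfl fun b _ => by ring

/-- A quantity that is polynomial in the logarithms of `d`, `n` and `1/η`, of degree `p` and with
leading factor `c`. -/
noncomputable def polylog (c : ℝ) (p : ℕ) (d n : ℕ) (η : ℝ) : ℝ :=
  c * (1 + Real.log d + Real.log n + Real.log (1 / η)) ^ p

/-!
Write `S` for the error matrix, `m = ‖M‖`, `q(x) = xᵀ M x` and
`ℓ = 1 + log d + log n + log (1/η)`; suppose first that `M` is deterministic. For a fixed vector
`w` the value `wᵀ S w` is half the deviation of the empirical mean of `q(xᵢ) ⟪w, xᵢ⟫²` from its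
expectation, because `𝔼 q(x) ⟪w, x⟫² = tr(M) ‖w‖² + 2 wᵀ M w`
(`integral_dotProduct_mulVec_mul_inner_sq`). As `S` is symmetric, it suffices to control these
deviations for `w` in a finite net of the unit ball (`norm_le_of_forall_gridPoint`). Because `ℓ`
contains `log d`, a cubic grid of mesh `1/(8d)` is fine enough and small enough, although it has
`(16 d + 1)^d` points instead of the optimal `exp(O(d))`.

The variables `q(xᵢ) ⟪w, xᵢ⟫²` are too heavy-tailed for a union bound over so many `w`, so the
factor `q(xᵢ)`, which does not depend on `w`, is truncated at level `T` of order `k m ℓ`.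
* Since `|q(x)|` is at most `m` times a sum of at most `k` squares of standard Gaussian variables,
  no truncation takes place with high probability (`measureReal_lt_abs_dotProduct_mulVec_le`), and
  the truncation shifts the expectations by a negligible amount
  (`abs_integral_truncQuadForm_sub_le`).
* A truncated variable is dominated by `T ⟪w, x⟫²`, hence subexponential, and Bernstein's
  inequality bounds the probability of a deviation `δ m / 2` by
  `2 exp(- n δ² m² / (3072 T²))` (`measureReal_abs_sum_ge_le`). Here the exponent is at least a
  large multiple of `d ℓ`, which beats the size of the grid.

The estimate for deterministic `M` is `measureReal_norm_sensingError_le`. A random `M`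
independent of the design is then handled by Fubini's theorem.
-/

open scoped RealInnerProductSpace

/-! ### Moments of standard Gaussian vectors -/

theorem integrable_exp_sq_div_four_gaussianReal :
    Integrable (fun x : ℝ => Real.exp (x ^ 2 / 4)) (gaussianReal 0 1) := by
  rw [gaussianReal_of_var_ne_zero _ one_ne_zero,
    integrable_withDensity_iff (measurable_gaussianPDF 0 1) (by simp [gaussianPDF])]
  refine ((integrable_exp_neg_mul_sq (b := 1 / 4) (by norm_num)).const_mul (√(2 * Real.pi))⁻¹).congr
    (.of_forall fun x => ?_)
  simp only [toReal_gaussianPDF, gaussianPDFReal, NNReal.coe_one, sub_zero, mul_one]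
  rw [mul_left_comm, ← Real.exp_add]
  ring_nf

theorem integral_exp_sq_div_four_gaussianReal :
    ∫ x : ℝ, Real.exp (x ^ 2 / 4) ∂(gaussianReal 0 1) = √2 := by
  rw [integral_gaussianReal_eq_integral_smul one_ne_zero]
  have h : ∀ x : ℝ, gaussianPDFReal 0 1 x • Real.exp (x ^ 2 / 4)
      = (√(2 * Real.pi))⁻¹ * Real.exp (-(1 / 4) * x ^ 2) := fun x => by
    simp only [gaussianPDFReal, NNReal.coe_one, sub_zero, mul_one, smul_eq_mul]
    rw [mul_assoc, ← Real.exp_add]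
    ring_nf
  simp_rw [h]
  rw [integral_const_mul, integral_gaussian, ← Real.sqrt_inv, ← Real.sqrt_mul (by positivity)]
  congr 1
  field_simp [Real.pi_ne_zero]
  norm_num

theorem integral_pow_four_gaussianReal : ∫ x : ℝ, x ^ 4 ∂(gaussianReal 0 1) = 3 := by
  rw [integral_gaussianReal_eq_integral_smul one_ne_zero]
  have h : ∀ x : ℝ, gaussianPDFReal 0 1 x • x ^ 4
      = (fun y : ℝ => (√(2 * Real.pi))⁻¹ * (y ^ (4 : ℝ) * Real.exp (-(1 / 2) * y ^ (2 : ℝ)))) |x| :=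
    fun x => by
    have h4 : |x| ^ 4 = x ^ 4 := Even.pow_abs ⟨2, rfl⟩ x
    simp only [gaussianPDFReal, NNReal.coe_one, sub_zero, mul_one, smul_eq_mul]
    rw [show (4 : ℝ) = (4 : ℕ) by norm_num, show (2 : ℝ) = (2 : ℕ) by norm_num,
      Real.rpow_natCast, Real.rpow_natCast, h4, sq_abs]
    push_cast
    ring_nf
  simp_rw [h]
  rw [integral_comp_abs (f := fun y : ℝ =>
      (√(2 * Real.pi))⁻¹ * (y ^ (4 : ℝ) * Real.exp (-(1 / 2) * y ^ (2 : ℝ)))),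
    integral_const_mul,
    integral_rpow_mul_exp_neg_mul_rpow (by norm_num) (by norm_num) (by norm_num)]
  have hG : Real.Gamma ((4 + 1) / 2) = 3 / 4 * √Real.pi := by
    rw [show ((4 : ℝ) + 1) / 2 = (1 / 2 + 1) + 1 by norm_num, Real.Gamma_add_one (by norm_num),
      Real.Gamma_add_one (by norm_num), Real.Gamma_one_half_eq]
    ring
  have h2 : ((1 : ℝ) / 2) ^ (-(4 + 1) / 2 : ℝ) = 4 * √2 := by
    rw [one_div, Real.inv_rpow (by norm_num), ← Real.rpow_neg (by norm_num),
      show -(-(4 + 1) / 2 : ℝ) = (2 : ℕ) + 1 / 2 by norm_num, Real.rpow_add (by norm_num),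
      Real.rpow_natCast, ← Real.sqrt_eq_rpow]
    norm_num
  rw [hG, h2, Real.sqrt_mul (by norm_num)]
  have := Real.sqrt_pos.2 Real.pi_pos
  have := Real.sqrt_pos.2 (zero_lt_two (α := ℝ))
  field_simp

section StdGaussian

variable {E : Type*} [NormedAddCommGroup E] [InnerProductSpace ℝ E] [FiniteDimensional ℝ E]
  [MeasurableSpace E] [BorelSpace E]

theorem map_inner_stdGaussian (v : E) :
    (stdGaussian E).map (fun x => ⟪v, x⟫) = (gaussianReal 0 1).map (‖v‖ * ·) := by
  have h := IsGaussian.map_eq_gaussianReal (μ := stdGaussian E) (innerSL ℝ v)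
  rw [integral_strongDual_stdGaussian, variance_dual_stdGaussian, innerSL_apply_norm] at h
  rw [gaussianReal_map_const_mul, mul_zero]
  convert h using 2
  · ext
    simp
  · rw [mul_one]
    exact (Real.toNNReal_of_nonneg (sq_nonneg _)).symm

theorem integrable_inner_pow_stdGaussian (v : E) (k : ℕ) :
    Integrable (fun x => ⟪v, x⟫ ^ k) (stdGaussian E) := by
  have h : Integrable (fun y : ℝ => y ^ k) ((stdGaussian E).map (fun x => ⟪v, x⟫)) := by
    rw [map_inner_stdGaussian, gaussianReal_map_const_mul]
    refine (memLp_id_gaussianReal k).integrable_norm_pow'.mono (by fun_prop)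
      (.of_forall fun y => ?_)
    simp
  exact h.comp_measurable (by fun_prop)

theorem integral_inner_pow_four_stdGaussian (v : E) :
    ∫ x, ⟪v, x⟫ ^ 4 ∂(stdGaussian E) = 3 * ‖v‖ ^ 4 := by
  have h : ∫ y, y ^ 4 ∂((stdGaussian E).map (fun x => ⟪v, x⟫)) = 3 * ‖v‖ ^ 4 := by
    rw [map_inner_stdGaussian, integral_map (by fun_prop) (by fun_prop)]
    simp_rw [mul_pow]
    rw [integral_const_mul, integral_pow_four_gaussianReal, mul_comm]
  rwa [integral_map (by fun_prop) (by fun_prop)] at h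

theorem integrable_inner_sq_mul_inner_sq (u v : E) :
    Integrable (fun x => ⟪u, x⟫ ^ 2 * ⟪v, x⟫ ^ 2) (stdGaussian E) := by
  refine ((integrable_inner_pow_stdGaussian u 4).add
    (integrable_inner_pow_stdGaussian v 4)).mono' (by fun_prop) (.of_forall fun x => ?_)
  rw [Real.norm_eq_abs, abs_of_nonneg (by positivity), Pi.add_apply]
  nlinarith [sq_nonneg (⟪u, x⟫ ^ 2 - ⟪v, x⟫ ^ 2), sq_nonneg (⟪u, x⟫ ^ 2 + ⟪v, x⟫ ^ 2)]

/-- The instance of Isserlis' theorem for two repeated linear forms. It follows by polarization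
from the fourth moments, so that it needs nothing but the one-dimensional marginals. -/
theorem integral_inner_sq_mul_inner_sq (u v : E) :
    ∫ x, ⟪u, x⟫ ^ 2 * ⟪v, x⟫ ^ 2 ∂(stdGaussian E) = ‖u‖ ^ 2 * ‖v‖ ^ 2 + 2 * ⟪u, v⟫ ^ 2 := by
  have h : ∀ x : E, ⟪u, x⟫ ^ 2 * ⟪v, x⟫ ^ 2
      = 1 / 12 * (⟪u + v, x⟫ ^ 4 + ⟪u - v, x⟫ ^ 4 - 2 * ⟪u, x⟫ ^ 4 - 2 * ⟪v, x⟫ ^ 4) := fun x => by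
    rw [inner_add_left, inner_sub_left]
    ring
  have hi := fun w : E => integrable_inner_pow_stdGaussian w 4
  simp_rw [h]
  have h1 : Integrable (fun x => ⟪u + v, x⟫ ^ 4 + ⟪u - v, x⟫ ^ 4) (stdGaussian E) :=
    (hi _).add (hi _)
  have h2 : Integrable (fun x => ⟪u + v, x⟫ ^ 4 + ⟪u - v, x⟫ ^ 4 - 2 * ⟪u, x⟫ ^ 4)
    (stdGaussian E) := h1.sub ((hi _).const_mul 2)
  rw [integral_const_mul, integral_sub h2 ((hi _).const_mul 2),
    integral_sub h1 ((hi _).const_mul 2), integral_add (hi _) (hi _), integral_const_mul,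
    integral_const_mul]
  simp_rw [integral_inner_pow_four_stdGaussian]
  have e1 := norm_add_sq_real u v
  have e2 := norm_sub_sq_real u v
  rw [show ‖u + v‖ ^ 4 = (‖u + v‖ ^ 2) ^ 2 by ring, show ‖u - v‖ ^ 4 = (‖u - v‖ ^ 2) ^ 2 by ring,
    e1, e2]
  ring

theorem integrable_exp_inner_sq {v : E} (hv : ‖v‖ ≤ 1) :
    Integrable (fun x => Real.exp (⟪v, x⟫ ^ 2 / 4)) (stdGaussian E) := by
  have h : Integrable (fun y : ℝ => Real.exp (y ^ 2 / 4))
      ((stdGaussian E).map (fun x => ⟪v, x⟫)) := by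
    rw [map_inner_stdGaussian, integrable_map_measure (by fun_prop) (by fun_prop)]
    refine integrable_exp_sq_div_four_gaussianReal.mono' (by fun_prop) (.of_forall fun x => ?_)
    rw [Real.norm_eq_abs, Function.comp_apply, Real.abs_exp]
    refine Real.exp_le_exp.2 (div_le_div_of_nonneg_right ?_ (by norm_num))
    rw [mul_pow]
    exact mul_le_of_le_one_left (sq_nonneg x) (pow_le_one₀ (norm_nonneg v) hv)
  exact h.comp_measurable (by fun_prop)

/-- For a unit vector the value is `√2`; the rational bound is all that is used. -/
theorem integral_exp_inner_sq_le {v : E} (hv : ‖v‖ ≤ 1) :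
    ∫ x, Real.exp (⟪v, x⟫ ^ 2 / 4) ∂(stdGaussian E) ≤ 3 / 2 := by
  have h : ∫ y, Real.exp (y ^ 2 / 4) ∂((stdGaussian E).map (fun x => ⟪v, x⟫)) ≤ 3 / 2 := by
    rw [map_inner_stdGaussian, integral_map (by fun_prop) (by fun_prop)]
    refine (integral_mono_of_nonneg (.of_forall fun x => (Real.exp_pos _).le)
      integrable_exp_sq_div_four_gaussianReal (.of_forall fun x => ?_)).trans
      (integral_exp_sq_div_four_gaussianReal.trans_le ?_)
    · refine Real.exp_le_exp.2 (div_le_div_of_nonneg_right ?_ (by norm_num))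
      rw [mul_pow]
      exact mul_le_of_le_one_left (sq_nonneg x) (pow_le_one₀ (norm_nonneg v) hv)
    · rw [Real.sqrt_le_left (by norm_num)]
      norm_num
  rwa [integral_map (by fun_prop) (by fun_prop)] at h

end StdGaussian

/-! ### Spectral decomposition of the quadratic form -/

section Spectral

variable {d : ℕ} {A : Matrix (Fin d) (Fin d) ℝ}

theorem dotProduct_mulVec_eq_inner (B : Matrix (Fin d) (Fin d) ℝ) (x : EuclideanSpace ℝ (Fin d)) :
    x.ofLp ⬝ᵥ (B *ᵥ x.ofLp) = ⟪x, Matrix.toEuclideanCLM (𝕜 := ℝ) B x⟫ := by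
  rw [Matrix.inner_toEuclideanCLM]

theorem abs_dotProduct_mulVec_le (B : Matrix (Fin d) (Fin d) ℝ) (x : EuclideanSpace ℝ (Fin d)) :
    |x.ofLp ⬝ᵥ (B *ᵥ x.ofLp)| ≤ ‖B‖ * ‖x‖ ^ 2 := by
  rw [dotProduct_mulVec_eq_inner, Matrix.cstar_norm_def]
  refine (abs_real_inner_le_norm _ _).trans ?_
  have := (Matrix.toEuclideanCLM (n := Fin d) (𝕜 := ℝ) B).le_opNorm x
  nlinarith [norm_nonneg x]

theorem dotProduct_mulVec_eq_sum_eigenvalues (hA : A.IsHermitian) (x : EuclideanSpace ℝ (Fin d)) :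
    x.ofLp ⬝ᵥ (A *ᵥ x.ofLp) = ∑ j, hA.eigenvalues j * ⟪hA.eigenvectorBasis j, x⟫ ^ 2 := by
  have hx : Matrix.toEuclideanCLM (𝕜 := ℝ) A x
      = ∑ j, ⟪hA.eigenvectorBasis j, x⟫ • hA.eigenvalues j • hA.eigenvectorBasis j := by
    conv_lhs => rw [← hA.eigenvectorBasis.sum_repr' x]
    rw [map_sum]
    refine Finset.sum_congr rfl fun j _ => ?_
    rw [map_smul]
    congr 1
    refine WithLp.ofLp_injective 2 ?_
    rw [Matrix.ofLp_toEuclideanCLM, hA.mulVec_eigenvectorBasis]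
    rfl
  rw [dotProduct_mulVec_eq_inner, hx, inner_sum]
  refine Finset.sum_congr rfl fun j _ => ?_
  rw [real_inner_smul_right, real_inner_smul_right, real_inner_comm]
  ring

theorem abs_eigenvalues_le (hA : A.IsHermitian) (j : Fin d) : |hA.eigenvalues j| ≤ ‖A‖ := by
  have h := abs_dotProduct_mulVec_le A (hA.eigenvectorBasis j)
  rw [hA.mulVec_eigenvectorBasis, hA.eigenvectorBasis.norm_eq_one] at h
  have h1 : (hA.eigenvectorBasis j).ofLp ⬝ᵥ (hA.eigenvectorBasis j).ofLp = 1 := by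
    have := EuclideanSpace.real_norm_sq_eq (hA.eigenvectorBasis j)
    rw [hA.eigenvectorBasis.norm_eq_one, one_pow] at this
    rw [this, dotProduct]
    exact Finset.sum_congr rfl fun i _ => (sq _).symm
  simpa [dotProduct_smul, h1] using h

/-- The squared norm of the projection of `x` onto the range of the symmetric matrix `A`, written
in an orthonormal basis of eigenvectors. -/
noncomputable def rangeNormSq (hA : A.IsHermitian) (x : EuclideanSpace ℝ (Fin d)) : ℝ :=
  ∑ j with hA.eigenvalues j ≠ 0, ⟪hA.eigenvectorBasis j, x⟫ ^ 2

theorem abs_dotProduct_mulVec_le_rangeNormSq (hA : A.IsHermitian)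
    (x : EuclideanSpace ℝ (Fin d)) :
    |x.ofLp ⬝ᵥ (A *ᵥ x.ofLp)| ≤ ‖A‖ * rangeNormSq hA x := by
  rw [dotProduct_mulVec_eq_sum_eigenvalues hA, rangeNormSq, Finset.mul_sum, Finset.sum_filter]
  refine (Finset.abs_sum_le_sum_abs _ _).trans (Finset.sum_le_sum fun j _ => ?_)
  split_ifs with h
  · rw [abs_mul, abs_sq]
    exact mul_le_mul_of_nonneg_right (abs_eigenvalues_le hA j) (sq_nonneg _)
  · rw [not_not.1 h]
    simp

theorem rangeNormSq_nonneg (hA : A.IsHermitian) (x : EuclideanSpace ℝ (Fin d)) :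
    0 ≤ rangeNormSq hA x := Finset.sum_nonneg fun _ _ => sq_nonneg _

theorem measurable_rangeNormSq (hA : A.IsHermitian) : Measurable (rangeNormSq hA) := by
  unfold rangeNormSq
  fun_prop

theorem card_eigenvalues_ne_zero (hA : A.IsHermitian) :
    (Finset.univ.filter fun j => hA.eigenvalues j ≠ 0).card = A.rank := by
  rw [hA.rank_eq_card_non_zero_eigs, Fintype.card_subtype]

/-- By Jensen's inequality the exponential of an average of squares of standard Gaussian
variables is controlled without any independence. -/
theorem exp_rangeNormSq_le (hA : A.IsHermitian) {k : ℕ} (hk : A.rank ≤ k) (h0 : 0 < A.rank)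
    (x : EuclideanSpace ℝ (Fin d)) :
    Real.exp (rangeNormSq hA x / (4 * k)) ≤ ∑ j with hA.eigenvalues j ≠ 0,
      (A.rank : ℝ)⁻¹ * Real.exp (⟪hA.eigenvectorBasis j, x⟫ ^ 2 / 4) := by
  have hr : (0 : ℝ) < A.rank := by exact_mod_cast h0
  have hrk : (A.rank : ℝ) ≤ k := by exact_mod_cast hk
  have hJ := convexOn_exp.map_sum_le (t := Finset.univ.filter fun j => hA.eigenvalues j ≠ 0)
    (w := fun _ => (A.rank : ℝ)⁻¹) (p := fun j => ⟪hA.eigenvectorBasis j, x⟫ ^ 2 / 4)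
    (fun _ _ => (inv_pos.2 hr).le)
    (by rw [Finset.sum_const, card_eigenvalues_ne_zero, nsmul_eq_mul, mul_inv_cancel₀ hr.ne'])
    (fun _ _ => Set.mem_univ _)
  simp only [smul_eq_mul] at hJ
  refine le_trans (Real.exp_le_exp.2 ?_) hJ
  rw [← Finset.mul_sum, ← Finset.sum_div, inv_mul_eq_div, div_div, mul_comm (4 : ℝ) (A.rank : ℝ),
    mul_comm (4 : ℝ) (k : ℝ)]
  exact div_le_div_of_nonneg_left (rangeNormSq_nonneg hA x) (by positivity) (by gcongr)

theorem integrable_exp_rangeNormSq (hA : A.IsHermitian) {k : ℕ} (hk : A.rank ≤ k)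
    (h0 : 0 < A.rank) :
    Integrable (fun x => Real.exp (rangeNormSq hA x / (4 * k)))
      (stdGaussian (EuclideanSpace ℝ (Fin d))) := by
  have hm := measurable_rangeNormSq hA
  refine (integrable_finsetSum (Finset.univ.filter fun j => hA.eigenvalues j ≠ 0) fun j _ =>
    (integrable_exp_inner_sq (hA.eigenvectorBasis.norm_eq_one j).le).const_mul (A.rank : ℝ)⁻¹).mono'
    (by fun_prop) (.of_forall fun x => ?_)
  rw [Real.norm_eq_abs, Real.abs_exp]
  exact exp_rangeNormSq_le hA hk h0 x

theorem integral_exp_rangeNormSq_le (hA : A.IsHermitian) {k : ℕ} (hk : A.rank ≤ k)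
    (h0 : 0 < A.rank) :
    ∫ x, Real.exp (rangeNormSq hA x / (4 * k)) ∂(stdGaussian (EuclideanSpace ℝ (Fin d)))
      ≤ 3 / 2 := by
  have hi := fun j => (integrable_exp_inner_sq
    (hA.eigenvectorBasis.norm_eq_one j).le).const_mul (A.rank : ℝ)⁻¹
  refine (integral_mono (integrable_exp_rangeNormSq hA hk h0)
    (integrable_finsetSum _ fun j _ => hi j) (exp_rangeNormSq_le hA hk h0)).trans ?_
  rw [integral_finsetSum _ fun j _ => hi j]
  refine (Finset.sum_le_sum (g := fun _ => (A.rank : ℝ)⁻¹ * (3 / 2)) fun j _ => ?_).trans ?_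
  · rw [integral_const_mul]
    gcongr
    exact integral_exp_inner_sq_le (hA.eigenvectorBasis.norm_eq_one j).le
  · rw [Finset.sum_const, card_eigenvalues_ne_zero, nsmul_eq_mul, mul_inv_cancel_left₀]
    exact_mod_cast h0.ne'

theorem integrable_dotProduct_mulVec_mul_inner_sq (hA : A.IsHermitian)
    (v : EuclideanSpace ℝ (Fin d)) :
    Integrable (fun x => x.ofLp ⬝ᵥ (A *ᵥ x.ofLp) * ⟪v, x⟫ ^ 2)
      (stdGaussian (EuclideanSpace ℝ (Fin d))) := by
  simp_rw [dotProduct_mulVec_eq_sum_eigenvalues hA, Finset.sum_mul, mul_assoc]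
  exact integrable_finsetSum _ fun j _ => (integrable_inner_sq_mul_inner_sq _ v).const_mul _

/-- In terms of matrices: `𝔼 (xᵀ A x) x xᵀ = tr(A) I + 2 A` for a standard Gaussian vector `x`. -/
theorem integral_dotProduct_mulVec_mul_inner_sq (hA : A.IsHermitian)
    (v : EuclideanSpace ℝ (Fin d)) :
    ∫ x, x.ofLp ⬝ᵥ (A *ᵥ x.ofLp) * ⟪v, x⟫ ^ 2 ∂(stdGaussian (EuclideanSpace ℝ (Fin d)))
      = A.trace * ‖v‖ ^ 2 + 2 * (v.ofLp ⬝ᵥ (A *ᵥ v.ofLp)) := by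
  simp_rw [dotProduct_mulVec_eq_sum_eigenvalues hA, Finset.sum_mul, mul_assoc]
  rw [integral_finsetSum _ fun j _ => (integrable_inner_sq_mul_inner_sq _ v).const_mul _]
  simp_rw [integral_const_mul, integral_inner_sq_mul_inner_sq, hA.eigenvectorBasis.norm_eq_one]
  rw [hA.trace_eq_sum_eigenvalues, Finset.sum_mul, Finset.mul_sum, ← Finset.sum_add_distrib]
  refine Finset.sum_congr rfl fun j _ => ?_
  simp
  ring

end Spectral

/-! ### A grid in the unit ball -/

section Net

variable {d : ℕ}

/-- The points with coordinates in `{-1, …, -1/N, 0, 1/N, …, 1}`. -/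
noncomputable def gridPoint (N : ℕ) (z : Fin d → Fin (2 * N + 1)) : EuclideanSpace ℝ (Fin d) :=
  WithLp.toLp 2 fun a => (((z a : ℕ) : ℝ) - N) / N

theorem exists_grid_coordinate {N : ℕ} (hN : 0 < N) {y : ℝ} (hy : |y| ≤ 1) :
    ∃ z : Fin (2 * N + 1),
      |(((z : ℕ) : ℝ) - N) / N| ≤ |y| ∧ |(((z : ℕ) : ℝ) - N) / N - y| ≤ 1 / N := by
  have hN' : (0 : ℝ) < N := by exact_mod_cast hN
  have hfl : ⌊|y| * N⌋₊ ≤ N := by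
    refine Nat.floor_le_of_le ?_
    nlinarith
  have h1 : (⌊|y| * N⌋₊ : ℝ) ≤ |y| * N := Nat.floor_le (by positivity)
  have h2 : |y| * N < ⌊|y| * N⌋₊ + 1 := Nat.lt_floor_add_one _
  generalize ⌊|y| * N⌋₊ = m at *
  have h3 : (m : ℝ) / N ≤ |y| := by rwa [div_le_iff₀ hN']
  have h4 : |y| - 1 / N ≤ (m : ℝ) / N := by
    rw [le_div_iff₀ hN', sub_mul, one_div, inv_mul_cancel₀ hN'.ne']
    linarith
  have h5 : (0 : ℝ) ≤ (m : ℝ) / N := by positivity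
  rcases le_total 0 y with h0 | h0
  · refine ⟨⟨N + m, by omega⟩, ?_⟩
    have e : (((N + m : ℕ) : ℝ) - N) / N = m / N := by push_cast; ring
    rw [abs_of_nonneg h0] at *
    simp only [e]
    rw [abs_of_nonneg h5, abs_le]
    exact ⟨h3, by linarith, by linarith [one_div_pos.2 hN']⟩
  · refine ⟨⟨N - m, by omega⟩, ?_⟩
    have e : (((N - m : ℕ) : ℝ) - N) / N = -(m / N) := by
      rw [Nat.cast_sub hfl]
      ring
    rw [abs_of_nonpos h0] at *
    simp only [e]
    rw [abs_neg, abs_of_nonneg h5, abs_le]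
    exact ⟨h3, by linarith [one_div_pos.2 hN'], by linarith⟩

/-- Rounding each coordinate towards `0` moves a point by at most `√d / (8d) ≤ 1/8` and keeps it
in the unit ball. -/
theorem exists_gridPoint (hd : 0 < d) {v : EuclideanSpace ℝ (Fin d)} (hv : ‖v‖ ≤ 1) :
    ∃ z : Fin d → Fin (2 * (8 * d) + 1),
      ‖gridPoint (8 * d) z‖ ≤ 1 ∧ ‖gridPoint (8 * d) z - v‖ ≤ 1 / 8 := by
  have hd' : (1 : ℝ) ≤ d := by exact_mod_cast hd
  have hc : ∀ a, |v.ofLp a| ≤ 1 := fun a => (PiLp.norm_apply_le v a).trans hv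
  choose z hz1 hz2 using fun a => exists_grid_coordinate (N := 8 * d) (by omega) (hc a)
  refine ⟨z, le_trans ?_ hv, ?_⟩
  · rw [EuclideanSpace.norm_eq, EuclideanSpace.norm_eq]
    refine Real.sqrt_le_sqrt (Finset.sum_le_sum fun a _ => ?_)
    exact pow_le_pow_left₀ (norm_nonneg _) (hz1 a) 2
  · rw [EuclideanSpace.norm_eq, Real.sqrt_le_left (by norm_num)]
    calc ∑ a, ‖(gridPoint (8 * d) z - v).ofLp a‖ ^ 2
        ≤ ∑ _a : Fin d, (1 / ((8 * d : ℕ) : ℝ)) ^ 2 :=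
          Finset.sum_le_sum fun a _ => pow_le_pow_left₀ (norm_nonneg _) (hz2 a) 2
      _ ≤ (1 / 8) ^ 2 := by
          rw [Finset.sum_const, Finset.card_univ, Fintype.card_fin, nsmul_eq_mul]
          push_cast
          field_simp
          exact hd'

/-- The norm of a symmetric matrix is the supremum of its quadratic form on the unit sphere. -/
theorem norm_le_of_forall_unit {S : Matrix (Fin d) (Fin d) ℝ} (hS : S.IsHermitian) {r : ℝ}
    (hr : 0 ≤ r) (h : ∀ v : EuclideanSpace ℝ (Fin d), ‖v‖ = 1 → |v.ofLp ⬝ᵥ (S *ᵥ v.ofLp)| ≤ r) :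
    ‖S‖ ≤ r := by
  have hT : (Matrix.toEuclideanCLM (n := Fin d) (𝕜 := ℝ) S).IsSymmetric := by
    intro x y
    have := Matrix.isSymmetric_toEuclideanLin_iff.2 hS x y
    exact this
  rw [Matrix.cstar_norm_def, ContinuousLinearMap.norm_eq_iSup_rayleighQuotient _ hT]
  refine ciSup_le fun x => ?_
  rcases eq_or_ne x 0 with rfl | hx
  · simpa using hr
  · have hx' : (‖x‖⁻¹ : ℝ) ≠ 0 := inv_ne_zero (norm_ne_zero_iff.2 hx)
    have hu : ‖‖x‖⁻¹ • x‖ = 1 := by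
      rw [norm_smul, norm_inv, norm_norm, inv_mul_cancel₀ (norm_ne_zero_iff.2 hx)]
    have := h _ hu
    rw [← ContinuousLinearMap.rayleigh_smul _ x hx', ContinuousLinearMap.rayleighQuotient, hu,
      ContinuousLinearMap.reApplyInnerSelf_apply]
    rw [dotProduct_mulVec_eq_inner, real_inner_comm] at this
    simpa using this

/-- A quadratic form is controlled on the unit sphere by its values on a grid. -/
theorem norm_le_of_forall_gridPoint (hd : 0 < d) {S : Matrix (Fin d) (Fin d) ℝ}
    (hS : S.IsHermitian) {r : ℝ} (hr : 0 ≤ r)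
    (h : ∀ z : Fin d → Fin (2 * (8 * d) + 1), ‖gridPoint (8 * d) z‖ ≤ 1 →
      |(gridPoint (8 * d) z).ofLp ⬝ᵥ (S *ᵥ (gridPoint (8 * d) z).ofLp)| ≤ r) :
    ‖S‖ ≤ 2 * r := by
  suffices hS' : ‖S‖ ≤ r + ‖S‖ / 4 by linarith [norm_nonneg S]
  refine norm_le_of_forall_unit hS (by positivity) fun v hv => ?_
  obtain ⟨z, hz, hzv⟩ := exists_gridPoint hd hv.le
  have hw := h z hz
  generalize gridPoint (8 * d) z = w at *
  rw [dotProduct_mulVec_eq_inner] at *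
  set T := Matrix.toEuclideanCLM (n := Fin d) (𝕜 := ℝ) S
  have hT : ‖S‖ = ‖T‖ := Matrix.cstar_norm_def S
  have e : ⟪v, T v⟫ = ⟪w, T w⟫ - ⟪w - v, T w⟫ - ⟪v, T (w - v)⟫ := by
    rw [inner_sub_left, map_sub, inner_sub_right]
    ring
  have b1 : |⟪w - v, T w⟫| ≤ 1 / 8 * ‖S‖ := by
    refine (abs_real_inner_le_norm _ _).trans ?_
    have := T.le_opNorm_of_le hz
    rw [hT]
    calc _ ≤ 1 / 8 * (‖T‖ * 1) := by gcongr
      _ = _ := by ring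
  have b2 : |⟪v, T (w - v)⟫| ≤ 1 / 8 * ‖S‖ := by
    refine (abs_real_inner_le_norm _ _).trans ?_
    have := T.le_opNorm_of_le hzv
    rw [hT, hv]
    linarith
  rw [e]
  rw [abs_le] at *
  constructor <;> linarith [b1.1, b1.2, b2.1, b2.2, hw.1, hw.2]

end Net

/-! ### Concentration of variables dominated by the square of a Gaussian -/

section Concentration

theorem exp_le_one_add_add_sq_mul_exp_abs (y : ℝ) :
    Real.exp y ≤ 1 + y + y ^ 2 * Real.exp |y| := by
  have h := Complex.norm_exp_sub_sum_le_norm_mul_exp (y : ℂ) 2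
  rw [Finset.sum_range_succ, Finset.sum_range_one] at h
  simp only [pow_zero, Nat.factorial_zero, Nat.cast_one, div_one, pow_one, Nat.factorial_one,
    Complex.norm_real, Real.norm_eq_abs, sq_abs] at h
  rw [← Complex.ofReal_exp, ← Complex.ofReal_one, ← Complex.ofReal_add, ← Complex.ofReal_sub,
    Complex.norm_real, Real.norm_eq_abs] at h
  linarith [le_abs_self (Real.exp y - (1 + y))]

theorem abs_mul_le_of_abs_le_mul_sq {E : Type*} {Z g : E → ℝ} {T : ℝ}
    (hZg : ∀ x, |Z x| ≤ T * g x ^ 2) {s : ℝ} (hs : |s| * T ≤ 1 / 8) (x : E) : |s * Z x| ≤ g x ^ 2 / 8 := by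
  rw [abs_mul]
  calc |s| * |Z x| ≤ |s| * (T * g x ^ 2) := by gcongr; exact hZg x
    _ = (|s| * T) * g x ^ 2 := by ring
    _ ≤ 1 / 8 * g x ^ 2 := by gcongr
    _ = _ := by ring

variable {E : Type*} [MeasurableSpace E] {γ : Measure E} {Z g : E → ℝ} {T : ℝ}

theorem integrable_exp_mul_of_abs_le_mul_sq (hZ : Measurable Z)
    (hZg : ∀ x, |Z x| ≤ T * g x ^ 2)
    (hgi : Integrable (fun x => Real.exp (g x ^ 2 / 4)) γ) {s : ℝ} (hs : |s| * T ≤ 1 / 8) :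
    Integrable (fun x => Real.exp (s * Z x)) γ := by
  refine hgi.mono' (by fun_prop) (.of_forall fun x => ?_)
  rw [Real.norm_eq_abs, Real.abs_exp, Real.exp_le_exp]
  have := le_abs_self (s * Z x)
  have := abs_mul_le_of_abs_le_mul_sq hZg hs x
  nlinarith [sq_nonneg (g x)]

theorem integrable_of_abs_le_mul_sq (hT : 0 ≤ T) (hZ : Measurable Z)
    (hZg : ∀ x, |Z x| ≤ T * g x ^ 2)
    (hgi : Integrable (fun x => Real.exp (g x ^ 2 / 4)) γ) : Integrable Z γ := by
  refine (hgi.const_mul (4 * T)).mono' (by fun_prop) (.of_forall fun x => ?_)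
  refine (hZg x).trans ?_
  have := Real.add_one_le_exp (g x ^ 2 / 4)
  nlinarith

/-- A variable dominated by the square of a Gaussian is subexponential. -/
theorem mgf_le_of_abs_le_mul_sq [IsProbabilityMeasure γ] (hT : 0 ≤ T) (hZ : Measurable Z)
    (hZg : ∀ x, |Z x| ≤ T * g x ^ 2) (hgi : Integrable (fun x => Real.exp (g x ^ 2 / 4)) γ)
    (hg : ∫ x, Real.exp (g x ^ 2 / 4) ∂γ ≤ 3 / 2) {s : ℝ} (hs : |s| * T ≤ 1 / 8) :
    mgf Z γ s ≤ Real.exp (s * ∫ x, Z x ∂γ + 192 * s ^ 2 * T ^ 2) := by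
  have hZi := integrable_of_abs_le_mul_sq hT hZ hZg hgi
  have hpt : ∀ x, Real.exp (s * Z x)
      ≤ 1 + s * Z x + 128 * s ^ 2 * T ^ 2 * Real.exp (g x ^ 2 / 4) := fun x => by
    refine (exp_le_one_add_add_sq_mul_exp_abs _).trans ?_
    have h1 := abs_mul_le_of_abs_le_mul_sq hZg hs x
    have h2 : (s * Z x) ^ 2 ≤ s ^ 2 * T ^ 2 * (g x ^ 2) ^ 2 := by
      rw [mul_pow, mul_assoc, ← mul_pow T, ← sq_abs (Z x)]
      gcongr
      exact hZg x
    have h3 : (g x ^ 2) ^ 2 ≤ 128 * Real.exp (g x ^ 2 / 8) := by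
      have := Real.quadratic_le_exp_of_nonneg (x := g x ^ 2 / 8) (by positivity)
      nlinarith [sq_nonneg (g x)]
    have h4 : Real.exp (g x ^ 2 / 8) * Real.exp (g x ^ 2 / 8) = Real.exp (g x ^ 2 / 4) := by
      rw [← Real.exp_add]
      ring_nf
    have : (s * Z x) ^ 2 * Real.exp |s * Z x| ≤ s ^ 2 * T ^ 2 * (128 * Real.exp (g x ^ 2 / 8))
        * Real.exp (g x ^ 2 / 8) := by
      gcongr
      exact h2.trans (by gcongr)
    rw [← h4]
    linarith
  have hb : Integrable (fun x => 1 + s * Z x) γ := (integrable_const 1).add (hZi.const_mul s)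
  calc mgf Z γ s ≤ ∫ x, (1 + s * Z x + 128 * s ^ 2 * T ^ 2 * Real.exp (g x ^ 2 / 4)) ∂γ :=
        integral_mono (integrable_exp_mul_of_abs_le_mul_sq hZ hZg hgi hs)
          (hb.add (hgi.const_mul _)) hpt
    _ = 1 + s * ∫ x, Z x ∂γ + 128 * s ^ 2 * T ^ 2 * ∫ x, Real.exp (g x ^ 2 / 4) ∂γ := by
        rw [integral_add hb (hgi.const_mul _), integral_add (integrable_const 1) (hZi.const_mul s),
          integral_const_mul, integral_const_mul]
        simp
    _ ≤ 1 + s * ∫ x, Z x ∂γ + 128 * s ^ 2 * T ^ 2 * (3 / 2) := by gcongr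
    _ = s * ∫ x, Z x ∂γ + 192 * s ^ 2 * T ^ 2 + 1 := by ring
    _ ≤ _ := Real.add_one_le_exp _

variable {Ω : Type*} [MeasurableSpace Ω] {μ : Measure Ω} {n : ℕ}
  {X : Fin n → Ω → E}

/-- Bernstein's inequality for independent copies of a variable dominated by the square of a
Gaussian. -/
theorem measureReal_sum_ge_le [IsProbabilityMeasure γ] [IsProbabilityMeasure μ]
    (hX : ∀ i, HasLaw (X i) γ μ) (hind : iIndepFun X μ)
    (hT : 0 < T) (hZ : Measurable Z) (hZg : ∀ x, |Z x| ≤ T * g x ^ 2)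
    (hgi : Integrable (fun x => Real.exp (g x ^ 2 / 4)) γ)
    (hg : ∫ x, Real.exp (g x ^ 2 / 4) ∂γ ≤ 3 / 2) {t : ℝ} (ht : 0 ≤ t) (htT : t ≤ 48 * T) :
    μ.real {ω | n * (∫ x, Z x ∂γ) + n * t ≤ ∑ i, Z (X i ω)}
      ≤ Real.exp (-(n * t ^ 2 / (768 * T ^ 2))) := by
  -- this value minimizes the exponent `-s t + 192 s² T²`
  set s := t / (384 * T ^ 2) with hs_def
  have hs0 : 0 ≤ s := by positivity
  have hs : |s| * T ≤ 1 / 8 := by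
    rw [abs_of_nonneg hs0, hs_def, div_mul_eq_mul_div, div_le_iff₀ (by positivity)]
    nlinarith
  have hindZ : iIndepFun (fun i ω => Z (X i ω)) μ := hind.comp (fun _ => Z) fun _ => hZ
  have hZm : ∀ i, AEMeasurable (fun ω => Z (X i ω)) μ :=
    fun i => hZ.comp_aemeasurable (hX i).aemeasurable
  have hmgf : ∀ i, mgf (fun ω => Z (X i ω)) μ s = mgf Z γ s := fun i => by
    rw [← (hX i).map_eq, mgf_map (hX i).aemeasurable (by fun_prop)]
    rfl
  have hint : ∀ i, Integrable (fun ω => Real.exp (s * Z (X i ω))) μ := fun i => by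
    have := integrable_exp_mul_of_abs_le_mul_sq hZ hZg hgi hs
    rw [← (hX i).map_eq] at this
    exact this.comp_aemeasurable (hX i).aemeasurable
  have hmgfsum : mgf (∑ i, fun ω => Z (X i ω)) μ s = mgf Z γ s ^ n := by
    rw [hindZ.mgf_sum₀ hZm]
    simp [hmgf]
  -- were the sum not exponentially integrable, its `mgf` would be the junk value `0`, while the
  -- product formula shows that it is positive
  have hsumint : Integrable (fun ω => Real.exp (s * (∑ i, fun ω => Z (X i ω)) ω)) μ := by
    by_contra hcon
    have : mgf (∑ i, fun ω => Z (X i ω)) μ s = 0 := integral_undef hcon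
    rw [hmgfsum] at this
    exact (pow_pos (mgf_pos (integrable_exp_mul_of_abs_le_mul_sq hZ hZg hgi hs)) n).ne' this
  have h := measure_ge_le_exp_mul_mgf (μ := μ) (X := ∑ i, fun ω => Z (X i ω))
    (n * (∫ x, Z x ∂γ) + n * t) hs0 hsumint
  rw [hmgfsum] at h
  simp only [Finset.sum_apply] at h
  refine h.trans ?_
  calc Real.exp (-s * (n * (∫ x, Z x ∂γ) + n * t)) * mgf Z γ s ^ n
      ≤ Real.exp (-s * (n * (∫ x, Z x ∂γ) + n * t))
        * Real.exp (s * ∫ x, Z x ∂γ + 192 * s ^ 2 * T ^ 2) ^ n := by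
        gcongr
        · exact mgf_nonneg
        · exact mgf_le_of_abs_le_mul_sq hT.le hZ hZg hgi hg hs
    _ = Real.exp (-(n * t ^ 2 / (768 * T ^ 2))) := by
        rw [← Real.exp_nat_mul, ← Real.exp_add, hs_def]
        congr 1
        field_simp
        ring

theorem measureReal_abs_sum_ge_le [IsProbabilityMeasure γ] [IsProbabilityMeasure μ]
    (hX : ∀ i, HasLaw (X i) γ μ) (hind : iIndepFun X μ)
    (hT : 0 < T) (hZ : Measurable Z) (hZg : ∀ x, |Z x| ≤ T * g x ^ 2)
    (hgi : Integrable (fun x => Real.exp (g x ^ 2 / 4)) γ)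
    (hg : ∫ x, Real.exp (g x ^ 2 / 4) ∂γ ≤ 3 / 2) {t : ℝ} (ht : 0 ≤ t) (htT : t ≤ 48 * T) :
    μ.real {ω | n * t ≤ |∑ i, Z (X i ω) - n * ∫ x, Z x ∂γ|}
      ≤ 2 * Real.exp (-(n * t ^ 2 / (768 * T ^ 2))) := by
  have h1 := measureReal_sum_ge_le hX hind hT hZ hZg hgi hg ht htT
  have h2 := measureReal_sum_ge_le hX hind hT hZ.neg (fun x => by simpa using hZg x) hgi hg ht htT
  simp only [Pi.neg_apply, integral_neg, Finset.sum_neg_distrib] at h2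
  refine (measureReal_mono (s₂ := {ω | n * (∫ x, Z x ∂γ) + n * t ≤ ∑ i, Z (X i ω)} ∪
    {ω | n * -(∫ x, Z x ∂γ) + n * t ≤ -∑ i, Z (X i ω)}) fun ω hω => ?_).trans
    ((measureReal_union_le _ _).trans (by linarith))
  rw [Set.mem_ofPred_eq, le_abs] at hω
  simp only [Set.mem_union, Set.mem_ofPred_eq]
  rcases hω with hω | hω
  · left; linarith
  · right; linarith

end Concentration

/-! ### Truncation of the quadratic form -/

section Truncation

variable {d : ℕ} {A : Matrix (Fin d) (Fin d) ℝ}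

/-- The quadratic form `x ↦ xᵀ A x`, replaced by `0` where its absolute value exceeds `T`. -/
noncomputable def truncQuadForm (A : Matrix (Fin d) (Fin d) ℝ) (T : ℝ)
    (x : EuclideanSpace ℝ (Fin d)) : ℝ :=
  if |x.ofLp ⬝ᵥ (A *ᵥ x.ofLp)| ≤ T then x.ofLp ⬝ᵥ (A *ᵥ x.ofLp) else 0

theorem measurable_dotProduct_mulVec (A : Matrix (Fin d) (Fin d) ℝ) :
    Measurable fun x : EuclideanSpace ℝ (Fin d) => x.ofLp ⬝ᵥ (A *ᵥ x.ofLp) := by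
  simp_rw [dotProduct_mulVec_eq_inner]
  fun_prop

theorem measurable_truncQuadForm (A : Matrix (Fin d) (Fin d) ℝ) (T : ℝ) :
    Measurable (truncQuadForm A T) :=
  Measurable.ite (measurableSet_le (measurable_dotProduct_mulVec A).abs measurable_const)
    (measurable_dotProduct_mulVec A) measurable_const

theorem abs_truncQuadForm_le (A : Matrix (Fin d) (Fin d) ℝ) {T : ℝ} (hT : 0 ≤ T)
    (x : EuclideanSpace ℝ (Fin d)) : |truncQuadForm A T x| ≤ T := by
  unfold truncQuadForm
  split_ifs with h
  · exact h
  · simpa using hT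

/-- Markov's inequality for `exp (rangeNormSq / 4k)`. -/
theorem measureReal_lt_abs_dotProduct_mulVec_le (hA : A.IsHermitian) {k : ℕ} (hk : A.rank ≤ k)
    (h0 : 0 < A.rank) (hn : 0 < ‖A‖) (L : ℝ) :
    (stdGaussian (EuclideanSpace ℝ (Fin d))).real
      {x | 4 * k * ‖A‖ * L < |x.ofLp ⬝ᵥ (A *ᵥ x.ofLp)|} ≤ 3 / 2 * Real.exp (-L) := by
  have hk0 : (0 : ℝ) < k := by exact_mod_cast h0.trans_le hk
  have h := mul_meas_ge_le_integral_of_nonneg (.of_forall fun x => (Real.exp_pos _).le)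
    (integrable_exp_rangeNormSq hA hk h0) (Real.exp L)
  have h' := h.trans (integral_exp_rangeNormSq_le hA hk h0)
  rw [Real.exp_neg, ← div_eq_mul_inv, le_div_iff₀ (Real.exp_pos L), mul_comm]
  refine le_trans (mul_le_mul_of_nonneg_left (measureReal_mono fun x hx => ?_)
    (Real.exp_pos L).le) h'
  rw [Set.mem_ofPred_eq] at hx ⊢
  rw [Real.exp_le_exp, le_div_iff₀ (by positivity)]
  have := hx.trans_le (abs_dotProduct_mulVec_le_rangeNormSq hA x)
  nlinarith

/-- Discarding the large values of the quadratic form changes the expectation by an exponentially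
small amount. -/
theorem abs_integral_truncQuadForm_sub_le (hA : A.IsHermitian) {k : ℕ} (hk : A.rank ≤ k)
    (h0 : 0 < A.rank) (hn : 0 < ‖A‖) (L : ℝ) {v : EuclideanSpace ℝ (Fin d)} (hv : ‖v‖ ≤ 1) :
    |∫ x, truncQuadForm A (16 * k * ‖A‖ * L) x * ⟪v, x⟫ ^ 2
        ∂(stdGaussian (EuclideanSpace ℝ (Fin d)))
      - (A.trace * ‖v‖ ^ 2 + 2 * (v.ofLp ⬝ᵥ (A *ᵥ v.ofLp)))|
      ≤ 192 * k * ‖A‖ * Real.exp (-L) := by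
  have hk0 : (0 : ℝ) < k := by exact_mod_cast h0.trans_le hk
  set T := 16 * k * ‖A‖ * L with hT
  have hi := integrable_dotProduct_mulVec_mul_inner_sq hA v
  have hti : Integrable (fun x => truncQuadForm A T x * ⟪v, x⟫ ^ 2)
      (stdGaussian (EuclideanSpace ℝ (Fin d))) := by
    have := measurable_truncQuadForm A T
    refine hi.mono (by fun_prop) (.of_forall fun x => ?_)
    unfold truncQuadForm
    split_ifs
    · exact le_rfl
    · rw [zero_mul, norm_zero]
      exact norm_nonneg _
  rw [← integral_dotProduct_mulVec_mul_inner_sq hA v, ← integral_sub hti hi]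
  have hQi := integrable_exp_rangeNormSq hA hk h0
  have hvi := integrable_exp_inner_sq hv
  -- the indicator of the truncated region is at most `exp (Q / 16k - L)`, where `Q` is
  -- `rangeNormSq hA x`; the loss of a factor `Q ⟪v, x⟫²` is absorbed by exponentials, and
  -- `2 a b ≤ a² + b²` replaces the joint law of `Q` and `⟪v, x⟫` by the two marginal ones
  have hpt : ∀ x : EuclideanSpace ℝ (Fin d),
      |truncQuadForm A T x * ⟪v, x⟫ ^ 2 - x.ofLp ⬝ᵥ (A *ᵥ x.ofLp) * ⟪v, x⟫ ^ 2|
        ≤ 64 * k * ‖A‖ * Real.exp (-L)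
          * (Real.exp (rangeNormSq hA x / (4 * k)) + Real.exp (⟪v, x⟫ ^ 2 / 4)) := fun x => by
    rw [← sub_mul, abs_mul, abs_sq]
    unfold truncQuadForm
    split_ifs with h
    · rw [sub_self, abs_zero, zero_mul]
      positivity
    · rw [zero_sub, abs_neg]
      rw [not_le] at h
      have hq := abs_dotProduct_mulVec_le_rangeNormSq hA x
      set Q := rangeNormSq hA x
      have hQ : rangeNormSq hA x = Q := rfl
      set a := Q / (16 * k) with ha
      have hQa : Q = 16 * k * a := by rw [ha]; field_simp
      have hLa : L ≤ a := by
        rw [ha, le_div_iff₀ (by positivity)]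
        have := h.trans_le hq
        nlinarith
      have h1 : |x.ofLp ⬝ᵥ (A *ᵥ x.ofLp)| ≤ 16 * k * ‖A‖ * Real.exp a := by
        have := Real.add_one_le_exp a
        calc _ ≤ ‖A‖ * Q := hq
          _ = 16 * k * ‖A‖ * a := by rw [hQa]; ring
          _ ≤ _ := by gcongr; linarith
      have h2 : ⟪v, x⟫ ^ 2 ≤ 8 * Real.exp (⟪v, x⟫ ^ 2 / 8) := by
        have := Real.add_one_le_exp (⟪v, x⟫ ^ 2 / 8)
        linarith
      have h3 : 1 ≤ Real.exp (-L) * Real.exp a := by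
        rw [← Real.exp_add, Real.one_le_exp_iff]
        linarith
      have e1 : Real.exp (Q / (4 * k)) = (Real.exp a * Real.exp a) ^ 2 := by
        rw [← Real.exp_add, ← Real.exp_nat_mul, hQa]
        congr 1
        field_simp
        ring
      have e2 : Real.exp (⟪v, x⟫ ^ 2 / 4) = Real.exp (⟪v, x⟫ ^ 2 / 8) ^ 2 := by
        rw [← Real.exp_nat_mul]
        congr 1
        push_cast
        ring
      rw [e1, e2]
      calc |x.ofLp ⬝ᵥ (A *ᵥ x.ofLp)| * ⟪v, x⟫ ^ 2
          ≤ (16 * k * ‖A‖ * Real.exp a) * (8 * Real.exp (⟪v, x⟫ ^ 2 / 8))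
            * (Real.exp (-L) * Real.exp a) := by
            exact (mul_le_mul h1 h2 (sq_nonneg _) (by positivity)).trans
              (le_mul_of_one_le_right (by positivity) h3)
        _ = 64 * k * ‖A‖ * Real.exp (-L)
            * (2 * (Real.exp a * Real.exp a) * Real.exp (⟪v, x⟫ ^ 2 / 8)) := by ring
        _ ≤ _ := by
            gcongr
            exact two_mul_le_add_sq _ _
  refine (abs_integral_le_integral_abs).trans ((integral_mono (hti.sub hi).abs
    ((hQi.add hvi).const_mul _) hpt).trans ?_)
  simp only [Pi.add_apply]
  rw [integral_const_mul, integral_add hQi hvi]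
  have := integral_exp_rangeNormSq_le hA hk h0
  have := integral_exp_inner_sq_le hv
  calc _ ≤ 64 * k * ‖A‖ * Real.exp (-L) * (3 / 2 + 3 / 2) := by gcongr
    _ = _ := by ring

end Truncation

/-! ### The error matrix -/

section SensingError

variable {d n : ℕ}

/-- The error `(1/2n) 𝒜'𝒜(A) - ½ tr(A) I - A` of the rescaled and centred backprojection. -/
noncomputable def sensingError (x : Fin n → EuclideanSpace ℝ (Fin d))
    (A : Matrix (Fin d) (Fin d) ℝ) : Matrix (Fin d) (Fin d) ℝ :=
  (1 / (2 * (n : ℝ))) • sensingAdj x (sensingOp x A)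
    - ((1 / 2 : ℝ) * A.trace) • (1 : Matrix (Fin d) (Fin d) ℝ) - A

theorem isHermitian_sensingError (x : Fin n → EuclideanSpace ℝ (Fin d))
    {A : Matrix (Fin d) (Fin d) ℝ} (hA : A.IsHermitian) : (sensingError x A).IsHermitian := by
  have hA' : Aᵀ = A := hA
  unfold Matrix.IsHermitian sensingError sensingAdj
  rw [Matrix.conjTranspose_eq_transpose_of_trivial]
  simp [Matrix.transpose_sub, Matrix.transpose_smul, Matrix.transpose_sum,
    Matrix.transpose_vecMulVec, hA']

theorem dotProduct_sensingError_mulVec (x : Fin n → EuclideanSpace ℝ (Fin d))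
    (A : Matrix (Fin d) (Fin d) ℝ) (w : EuclideanSpace ℝ (Fin d)) :
    w.ofLp ⬝ᵥ (sensingError x A *ᵥ w.ofLp)
      = 1 / (2 * (n : ℝ)) * ∑ i, (x i).ofLp ⬝ᵥ (A *ᵥ (x i).ofLp) * ⟪w, x i⟫ ^ 2
        - 1 / 2 * (A.trace * ‖w‖ ^ 2 + 2 * (w.ofLp ⬝ᵥ (A *ᵥ w.ofLp))) := by
  have hi : ∀ i, ⟪w, x i⟫ = w.ofLp ⬝ᵥ (x i).ofLp := fun i => by
    rw [EuclideanSpace.inner_eq_star_dotProduct, dotProduct_comm]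
    rfl
  have hw : ‖w‖ ^ 2 = w.ofLp ⬝ᵥ w.ofLp := by
    rw [EuclideanSpace.real_norm_sq_eq, dotProduct]
    exact Finset.sum_congr rfl fun i _ => sq _
  have hs : w.ofLp ⬝ᵥ (sensingAdj x (sensingOp x A) *ᵥ w.ofLp)
      = ∑ i, (x i).ofLp ⬝ᵥ (A *ᵥ (x i).ofLp) * ⟪w, x i⟫ ^ 2 := by
    rw [sensingAdj, Matrix.sum_mulVec, dotProduct_sum]
    refine Finset.sum_congr rfl fun i _ => ?_
    rw [Matrix.smul_mulVec, Matrix.vecMulVec_mulVec, hi, dotProduct_smul, sensingOp]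
    simp only [dotProduct_comm (x i).ofLp w.ofLp, op_smul_eq_smul, dotProduct_smul, smul_eq_mul]
    ring
  unfold sensingError
  rw [Matrix.sub_mulVec, Matrix.sub_mulVec, Matrix.smul_mulVec, Matrix.smul_mulVec,
    Matrix.one_mulVec, dotProduct_sub, dotProduct_sub, dotProduct_smul, dotProduct_smul, hs, hw]
  simp only [smul_eq_mul]
  ring

/-- Deterministic conditions under which the sensing error is small. -/
theorem norm_sensingError_le (hd : 0 < d) (hn : 0 < n) (x : Fin n → EuclideanSpace ℝ (Fin d))
    {A : Matrix (Fin d) (Fin d) ℝ} (hA : A.IsHermitian) {T t : ℝ} (ht : 0 ≤ t)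
    (I : EuclideanSpace ℝ (Fin d) → ℝ)
    (hT : ∀ i, |(x i).ofLp ⬝ᵥ (A *ᵥ (x i).ofLp)| ≤ T)
    (hI : ∀ w, ‖w‖ ≤ 1 → |I w - (A.trace * ‖w‖ ^ 2 + 2 * (w.ofLp ⬝ᵥ (A *ᵥ w.ofLp)))| ≤ t)
    (hdev : ∀ z : Fin d → Fin (2 * (8 * d) + 1), ‖gridPoint (8 * d) z‖ ≤ 1 →
      |∑ i, truncQuadForm A T (x i) * ⟪gridPoint (8 * d) z, x i⟫ ^ 2
        - n * I (gridPoint (8 * d) z)| ≤ n * t) :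
    ‖sensingError x A‖ ≤ 2 * t := by
  have hn' : (0 : ℝ) < n := by exact_mod_cast hn
  refine norm_le_of_forall_gridPoint hd (isHermitian_sensingError x hA) ht fun z hz => ?_
  have h1 := hI _ hz
  have h2 := hdev z hz
  have htr : ∀ i, truncQuadForm A T (x i) = (x i).ofLp ⬝ᵥ (A *ᵥ (x i).ofLp) :=
    fun i => if_pos (hT i)
  simp_rw [htr] at h2
  rw [dotProduct_sensingError_mulVec]
  generalize gridPoint (8 * d) z = w at *
  generalize (∑ i, (x i).ofLp ⬝ᵥ (A *ᵥ (x i).ofLp) * ⟪w, x i⟫ ^ 2) = s at *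
  generalize A.trace * ‖w‖ ^ 2 + 2 * (w.ofLp ⬝ᵥ (A *ᵥ w.ofLp)) = b at *
  have e : 1 / (2 * (n : ℝ)) * s - 1 / 2 * b
      = 1 / (2 * (n : ℝ)) * (s - n * I w) + 1 / 2 * (I w - b) := by
    field_simp
    ring
  rw [e]
  refine (abs_add_le _ _).trans ?_
  rw [abs_mul, abs_mul, abs_of_nonneg (by positivity : (0 : ℝ) ≤ 1 / (2 * (n : ℝ))),
    abs_of_nonneg (by norm_num : (0 : ℝ) ≤ 1 / 2)]
  calc _ ≤ 1 / (2 * (n : ℝ)) * (n * t) + 1 / 2 * t := by gcongr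
    _ = t := by field_simp; ring

end SensingError

/-! ### The error for a deterministic matrix -/

section FixedMatrix

variable {d n : ℕ} {Ω : Type*} [MeasurableSpace Ω] {μ : Measure Ω} [IsProbabilityMeasure μ]
  {X : Fin n → Ω → EuclideanSpace ℝ (Fin d)} {A : Matrix (Fin d) (Fin d) ℝ}

/-- The union bound over the truncation events and over the grid, for the truncation level
`T = 16 k ‖A‖ L`. -/
theorem measureReal_lt_norm_sensingError_le (hd : 0 < d) (hn : 0 < n)
    (hX : ∀ i, HasLaw (X i) (stdGaussian (EuclideanSpace ℝ (Fin d))) μ) (hind : iIndepFun X μ)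
    (hA : A.IsHermitian) {k : ℕ} (hk : A.rank ≤ k) (h0 : 0 < A.rank) (hA0 : 0 < ‖A‖)
    {L t : ℝ} (ht : 0 ≤ t) (hL : 0 < L) (htL : t ≤ 48 * (16 * k * ‖A‖ * L))
    (hb : 192 * k * ‖A‖ * Real.exp (-L) ≤ t) :
    μ.real {ω | 2 * t < ‖sensingError (fun i => X i ω) A‖}
      ≤ n * (3 / 2 * Real.exp (-(4 * L))) + (2 * (8 * d) + 1) ^ d *
        (2 * Real.exp (-(n * t ^ 2 / (768 * (16 * k * ‖A‖ * L) ^ 2)))) := by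
  have hk0 : (0 : ℝ) < k := by exact_mod_cast h0.trans_le hk
  set T := 16 * k * ‖A‖ * L with hT_def
  have hT : 0 < T := by positivity
  set I : EuclideanSpace ℝ (Fin d) → ℝ := fun w => ∫ x, truncQuadForm A T x * ⟪w, x⟫ ^ 2
        ∂(stdGaussian (EuclideanSpace ℝ (Fin d))) with hI
  let B : Fin n → Set Ω := fun i => {ω | T < |(X i ω).ofLp ⬝ᵥ (A *ᵥ (X i ω).ofLp)|}
  let D : (Fin d → Fin (2 * (8 * d) + 1)) → Set Ω := fun z => {ω | ‖gridPoint (8 * d) z‖ ≤ 1 ∧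
    n * t ≤ |∑ i, truncQuadForm A T (X i ω) * ⟪gridPoint (8 * d) z, X i ω⟫ ^ 2
        - n * I (gridPoint (8 * d) z)|}
  have hsub : {ω | 2 * t < ‖sensingError (fun i => X i ω) A‖} ⊆ (⋃ i, B i) ∪ ⋃ z, D z := by
    intro ω hω
    by_contra hcon
    simp only [Set.mem_union, Set.mem_iUnion, not_or, not_exists] at hcon
    refine (not_le.2 hω) (norm_sensingError_le hd hn _ hA ht I (T := T)
      (fun i => not_lt.1 (hcon.1 i)) (fun w hw => ?_) fun z hz => ?_)
    · exact (abs_integral_truncQuadForm_sub_le hA hk h0 hA0 L hw).trans hb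
    · exact (not_le.1 fun hle => hcon.2 z ⟨hz, hle⟩).le
  have hB : ∀ i, μ.real (B i) ≤ 3 / 2 * Real.exp (-(4 * L)) := fun i => by
    have h := measureReal_lt_abs_dotProduct_mulVec_le hA hk h0 hA0 (4 * L)
    rw [show 4 * k * ‖A‖ * (4 * L) = T by rw [hT_def]; ring] at h
    rwa [← (hX i).measureReal_eq
      (measurableSet_lt measurable_const (measurable_dotProduct_mulVec A).abs)] at h
  have hD : ∀ z, μ.real (D z) ≤ 2 * Real.exp (-(n * t ^ 2 / (768 * T ^ 2))) := fun z => by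
    by_cases hz : ‖gridPoint (8 * d) z‖ ≤ 1
    · refine (measureReal_mono fun ω hω => hω.2).trans
        (measureReal_abs_sum_ge_le (g := fun x => ⟪gridPoint (8 * d) z, x⟫)
          (Z := fun x => truncQuadForm A T x * ⟪gridPoint (8 * d) z, x⟫ ^ 2) hX hind hT ?_
          (fun x => ?_) (integrable_exp_inner_sq hz) (integral_exp_inner_sq_le hz) ht htL)
      · have := measurable_truncQuadForm A T
        fun_prop
      · rw [abs_mul, abs_sq]
        exact mul_le_mul_of_nonneg_right (abs_truncQuadForm_le A hT.le x) (sq_nonneg _)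
    -- for grid points outside the unit ball the event `D z` is empty by definition
    · have : D z = ∅ := Set.eq_empty_of_forall_notMem fun ω hω => hz hω.1
      rw [this, measureReal_empty]
      positivity
  refine (measureReal_mono hsub).trans ((measureReal_union_le _ _).trans (add_le_add ?_ ?_))
  · refine (measureReal_iUnion_fintype_le _).trans
      ((Finset.sum_le_sum fun i _ => hB i).trans (le_of_eq ?_))
    simp
  · refine (measureReal_iUnion_fintype_le _).trans
      ((Finset.sum_le_sum fun i _ => hD i).trans (le_of_eq ?_))
    simp

theorem one_le_polylog_base (d n : ℕ) {η : ℝ} (h0 : 0 < η) (h1 : η < 1) :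
    1 ≤ 1 + Real.log d + Real.log n + Real.log (1 / η) := by
  have := Real.log_natCast_nonneg d
  have := Real.log_natCast_nonneg n
  have := Real.log_nonneg (one_le_one_div h0 h1.le)
  linarith

/-- The role of the logarithms in `polylog`: `exp (-ℓ) ≤ η / (2 n d)`. -/
theorem exp_neg_polylog_base (hd : 0 < d) (hn : 0 < n) {η : ℝ} (h0 : 0 < η) :
    2 * n * d * Real.exp (-(1 + Real.log d + Real.log n + Real.log (1 / η))) ≤ η := by
  have hd' : (0 : ℝ) < d := by exact_mod_cast hd
  have hn' : (0 : ℝ) < n := by exact_mod_cast hn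
  rw [Real.exp_neg, Real.exp_add, Real.exp_add, Real.exp_add, Real.exp_log hd', Real.exp_log hn',
    Real.exp_log (by positivity), ← div_eq_mul_inv, div_le_iff₀ (by positivity)]
  have := Real.add_one_le_exp 1
  have e : η * (Real.exp 1 * d * n * (1 / η)) = Real.exp 1 * (n * d) := by field_simp
  rw [e, mul_assoc]
  gcongr
  linarith

/-- The estimate for a deterministic matrix, with the truncation level `T = 160 k ‖A‖ ℓ`. -/
theorem measureReal_norm_sensingError_le {δ η : ℝ} {k : ℕ} (hδ : 0 < δ) (hδ1 : δ ≤ 1)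
    (hη : 0 < η) (hη1 : η < 1)
    (hX : ∀ i, HasLaw (X i) (stdGaussian (EuclideanSpace ℝ (Fin d))) μ) (hind : iIndepFun X μ)
    (hA : A.IsHermitian) (hk : A.rank ≤ k)
    (hkn : polylog (10 ^ 9) 3 d n η * (k : ℝ) ^ 3 * d / δ ^ 2 ≤ n) :
    μ.real {ω | δ * ‖A‖ < ‖sensingError (fun i => X i ω) A‖} ≤ η := by
  rcases eq_or_ne A 0 with rfl | hA0
  · have : ∀ x : Fin n → EuclideanSpace ℝ (Fin d), sensingError x 0 = 0 := fun x => by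
      have : sensingOp x 0 = 0 := by ext i; simp [sensingOp]
      simp [sensingError, this, sensingAdj]
    simp [this, hη.le]
  have hA0' : 0 < ‖A‖ := norm_pos_iff.2 hA0
  have h0 : 0 < A.rank := Nat.pos_of_ne_zero fun h => hA0 <| by
    rw [← card_eigenvalues_ne_zero hA, Finset.card_eq_zero, Finset.filter_eq_empty_iff] at h
    exact hA.eigenvalues_eq_zero_iff.1 (funext fun j => not_not.1 (h (Finset.mem_univ j)))
  have hd : 0 < d := by
    rcases Nat.eq_zero_or_pos d with rfl | h
    · exact absurd (Subsingleton.elim A 0) hA0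
    · exact h
  have hk0 : 0 < k := h0.trans_le hk
  have hk1 : (1 : ℝ) ≤ k := by exact_mod_cast hk0
  have hd1 : (1 : ℝ) ≤ d := by exact_mod_cast hd
  have hl := one_le_polylog_base d n hη hη1
  have hu := fun hn : 0 < n => exp_neg_polylog_base hd hn hη
  unfold polylog at hkn
  set l := 1 + Real.log d + Real.log n + Real.log (1 / η) with hl_def
  clear_value l
  rw [div_le_iff₀ (by positivity)] at hkn
  have hn : 0 < n := by
    by_contra hcon
    rw [Nat.eq_zero_of_not_pos hcon, Nat.cast_zero, zero_mul] at hkn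
    have : 0 < 10 ^ 9 * l ^ 3 * (k : ℝ) ^ 3 * d := by positivity
    linarith
  have hn1 : (1 : ℝ) ≤ n := by exact_mod_cast hn
  specialize hu hn
  set u := Real.exp (-l) with hu_def
  have hu0 : 0 < u := Real.exp_pos _
  have hu2 : u ≤ 1 / 2 := by
    have : 2 * u ≤ 2 * n * d * u := by
      have : (1 : ℝ) ≤ n * d := one_le_mul_of_one_le_of_one_le hn1 hd1
      nlinarith
    linarith
  -- the truncation parameter `L = 10 ℓ` makes `exp (-L)` small compared with `η / (n d)`
  have hu10 : Real.exp (-(10 * l)) ≤ u / 512 := by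
    have : Real.exp (-(10 * l)) = u * u ^ 9 := by
      rw [← pow_succ', hu_def, ← Real.exp_nat_mul]
      congr 1
      push_cast
      ring
    rw [this]
    have : u ^ 9 ≤ (1 / 2) ^ 9 := pow_le_pow_left₀ hu0.le hu2 9
    calc _ ≤ u * (1 / 2) ^ 9 := by gcongr
      _ = _ := by ring
  -- `k ≤ δ n`, since `k² ≤ δ² n`
  have hkδ : k ≤ δ * n := by
    have h1 : (k : ℝ) ^ 2 ≤ n * δ ^ 2 := by
      refine le_trans ?_ hkn
      have a1 : (1 : ℝ) ≤ 10 ^ 9 * l ^ 3 := by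
        have := one_le_pow₀ hl (n := 3)
        linarith
      have a2 : (k : ℝ) ^ 2 ≤ k ^ 3 := pow_le_pow_right₀ hk1 (by norm_num)
      calc (k : ℝ) ^ 2 = 1 * k ^ 2 * 1 := by ring
        _ ≤ _ := by gcongr
    refine abs_le_of_sq_le_sq' ?_ (by positivity) |>.2
    rw [mul_pow]
    nlinarith [sq_nonneg δ]
  have hmain := measureReal_lt_norm_sensingError_le (μ := μ) hd hn hX hind hA hk h0 hA0'
    (L := 10 * l) (t := δ * ‖A‖ / 2) (by positivity) (by positivity) ?_ ?_
  · rw [mul_div_cancel₀ _ (two_ne_zero' ℝ)] at hmain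
    refine hmain.trans ?_
    have p1 : n * (3 / 2 * Real.exp (-(4 * (10 * l)))) ≤ η / 2 := by
      have : Real.exp (-(4 * (10 * l))) ≤ Real.exp (-(10 * l)) :=
        Real.exp_le_exp.2 (by linarith)
      have : (n : ℝ) * u ≤ n * d * u := by
        have : (n : ℝ) ≤ n * d := le_mul_of_one_le_right (by positivity) hd1
        gcongr
      calc _ ≤ n * (3 / 2 * (u / 512)) := by gcongr; linarith
        _ ≤ η / 2 := by linarith
    have p2 : (2 * (8 * (d : ℝ)) + 1) ^ d * (2 * Real.exp (-(n * (δ * ‖A‖ / 2) ^ 2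
        / (768 * (16 * k * ‖A‖ * (10 * l)) ^ 2)))) ≤ η / 2 := by
      have e1 : (n : ℝ) * (δ * ‖A‖ / 2) ^ 2 / (768 * (16 * k * ‖A‖ * (10 * l)) ^ 2)
          = n * δ ^ 2 / (78643200 * k ^ 2 * l ^ 2) := by
        field_simp
        ring
      have e2 : d * (10 * l) ≤ n * δ ^ 2 / (78643200 * k ^ 2 * l ^ 2) := by
        rw [le_div_iff₀ (by positivity)]
        refine le_trans ?_ hkn
        calc d * (10 * l) * (78643200 * (k : ℝ) ^ 2 * l ^ 2)
            = 786432000 * l ^ 3 * (k ^ 2 * d) := by ring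
          _ ≤ 10 ^ 9 * l ^ 3 * (k ^ 3 * d) := by
              gcongr
              · norm_num
              · norm_num
          _ = _ := by ring
      have e3 : Real.exp (-(d * (10 * l))) = Real.exp (-(10 * l)) ^ d := by
        rw [← Real.exp_nat_mul]
        ring_nf
      have e4 : (2 * (8 * (d : ℝ)) + 1) * Real.exp (-(10 * l)) ≤ η / 4 := by
        have : (d : ℝ) * u ≤ n * d * u := by
          have : (d : ℝ) ≤ n * d := le_mul_of_one_le_left (by positivity) hn1
          gcongr
        calc _ ≤ (17 * d) * (u / 512) := by gcongr; linarith
          _ ≤ η / 4 := by linarith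
      rw [e1]
      calc _ ≤ (2 * (8 * (d : ℝ)) + 1) ^ d * (2 * Real.exp (-(d * (10 * l)))) := by gcongr
        _ = 2 * ((2 * (8 * (d : ℝ)) + 1) * Real.exp (-(10 * l))) ^ d := by
            rw [e3, mul_pow]
            ring
        _ ≤ 2 * (η / 4) ^ d := by gcongr
        _ ≤ 2 * (η / 4) := by
            gcongr
            exact pow_le_of_le_one (by positivity) (by linarith) hd.ne'
        _ = η / 2 := by ring
    linarith
  · have h1 : δ * ‖A‖ ≤ ‖A‖ := mul_le_of_le_one_left hA0'.le hδ1
    have h2 : ‖A‖ ≤ k * ‖A‖ * l := by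
      calc ‖A‖ = 1 * ‖A‖ * 1 := by ring
        _ ≤ _ := by gcongr
    linarith
  · have h1 : Real.exp (-(10 * l)) ≤ δ / (384 * k) := by
      rw [le_div_iff₀ (by positivity)]
      have : (n : ℝ) * u ≤ n * d * u := by
        have : (n : ℝ) ≤ n * d := le_mul_of_one_le_right (by positivity) hd1
        gcongr
      calc Real.exp (-(10 * l)) * (384 * k) ≤ u / 512 * (384 * (δ * n)) := by gcongr
        _ = δ * (n * u * (384 / 512)) := by ring
        _ ≤ δ * 1 := by
            gcongr
            linarith
        _ = δ := mul_one δ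
    calc _ ≤ 192 * k * ‖A‖ * (δ / (384 * k)) := by gcongr
      _ = _ := by field_simp; norm_num

end FixedMatrix

/-! ### Random matrices -/

section RandomMatrix

variable {d n : ℕ}

theorem continuous_sensingError :
    Continuous fun p : (Fin d → Fin d → ℝ) × (Fin n → EuclideanSpace ℝ (Fin d)) =>
      sensingError p.2 (Matrix.of p.1) := by
  have hof : Continuous fun p : (Fin d → Fin d → ℝ) × (Fin n → EuclideanSpace ℝ (Fin d)) =>
      (Matrix.of p.1 : Matrix (Fin d) (Fin d) ℝ) := continuous_fst
  have hx : ∀ i, Continuous fun p : (Fin d → Fin d → ℝ) × (Fin n → EuclideanSpace ℝ (Fin d)) =>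
      (p.2 i).ofLp := fun i => by fun_prop
  unfold sensingError sensingAdj sensingOp
  refine (Continuous.sub (Continuous.const_smul (M := ℝ) ?_ _)
    ((hof.matrix_trace.const_mul _).smul continuous_const)).sub hof
  refine continuous_finsetSum _ fun i _ => ?_
  exact ((hx i).dotProduct (hof.matrix_mulVec (hx i))).fun_smul ((hx i).matrix_vecMulVec (hx i))

theorem measurableSet_lt_norm_sensingError (δ : ℝ) :
    MeasurableSet {p : (Fin d → Fin d → ℝ) × (Fin n → EuclideanSpace ℝ (Fin d)) |
      δ * ‖(Matrix.of p.1 : Matrix (Fin d) (Fin d) ℝ)‖ < ‖sensingError p.2 (Matrix.of p.1)‖} := by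
  have hof : Continuous fun p : (Fin d → Fin d → ℝ) × (Fin n → EuclideanSpace ℝ (Fin d)) =>
      (Matrix.of p.1 : Matrix (Fin d) (Fin d) ℝ) := continuous_fst
  exact (isOpen_lt (continuous_const.mul hof.norm) continuous_sensingError.norm).measurableSet

end RandomMatrix

theorem theorem2 :
    ∃ (c : ℝ) (p : ℕ), 0 < c ∧
      ∀ (d n k : ℕ) (δ η : ℝ), 0 < δ → δ ≤ 1 → 0 < η → η < 1 →
      ∀ {Ω : Type*} [MeasurableSpace Ω] (μ : Measure Ω) [IsProbabilityMeasure μ]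
        (X : Fin n → Ω → EuclideanSpace ℝ (Fin d))
        (M : Ω → Matrix (Fin d) (Fin d) ℝ),
        (∀ i, HasLaw (X i) (stdGaussian (EuclideanSpace ℝ (Fin d))) μ) →
        iIndepFun X μ →
        AEMeasurable (fun ω (a b : Fin d) => M ω a b) μ →
        IndepFun (fun ω (a b : Fin d) => M ω a b) (fun ω (i : Fin n) => X i ω) μ →
        (∀ᵐ ω ∂μ, (M ω).IsSymm ∧ (M ω).rank ≤ k) →
        polylog c p d n η * (k : ℝ) ^ 3 * d / δ ^ 2 ≤ n →
        1 - η ≤ μ.real {ω |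
          ‖(1 / (2 * (n : ℝ))) • sensingAdj (fun i => X i ω) (sensingOp (fun i => X i ω) (M ω))
              - ((1 / 2 : ℝ) * (M ω).trace) • (1 : Matrix (Fin d) (Fin d) ℝ) - M ω‖
            ≤ δ * ‖M ω‖} := by
  refine ⟨10 ^ 9, 3, by norm_num, ?_⟩
  intro d n k δ η hδ hδ1 hη hη1 Ω _ μ _ X M hX hind hMm hMX hM hkn
  set π := Measure.pi fun _ : Fin n => stdGaussian (EuclideanSpace ℝ (Fin d)) with hπ
  let N : Ω → Fin d → Fin d → ℝ := fun ω a b => M ω a b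
  let bad := {p : (Fin d → Fin d → ℝ) × (Fin n → EuclideanSpace ℝ (Fin d)) |
      δ * ‖(Matrix.of p.1 : Matrix (Fin d) (Fin d) ℝ)‖ < ‖sensingError p.2 (Matrix.of p.1)‖}
  have hbad : MeasurableSet bad := measurableSet_lt_norm_sensingError δ
  have hlaw : HasLaw (fun ω => (N ω, fun i => X i ω)) ((μ.map N).prod π) μ :=
    IndepFun.hasLaw_prod (X := N) { aemeasurable := hMm, map_eq := rfl } (hind.hasLaw_pi hX) hMX
  -- the coordinates of the product space are independent standard Gaussian vectors
  have hπX : ∀ i, HasLaw (fun x : Fin n → EuclideanSpace ℝ (Fin d) => x i)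
      (stdGaussian (EuclideanSpace ℝ (Fin d))) π :=
    fun i => (measurePreserving_eval
      (fun _ : Fin n => stdGaussian (EuclideanSpace ℝ (Fin d))) i).hasLaw
  have hπind : iIndepFun (fun i (x : Fin n → EuclideanSpace ℝ (Fin d)) => x i) π :=
    iIndepFun_pi (X := fun _ => id) fun _ => aemeasurable_id
  have hfix : ∀ᵐ ω ∂μ, π (Prod.mk (N ω) ⁻¹' bad) ≤ ENNReal.ofReal η := by
    filter_upwards [hM] with ω hω
    have hA : (M ω).IsHermitian := by
      rw [Matrix.IsHermitian, Matrix.conjTranspose_eq_transpose_of_trivial]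
      exact hω.1
    exact (ENNReal.le_ofReal_iff_toReal_le (measure_ne_top _ _) hη.le).2
      (measureReal_norm_sensingError_le hδ hδ1 hη hη1 hπX hπind hA hω.2 hkn)
  have hprob : μ {ω | (N ω, fun i => X i ω) ∈ bad} ≤ ENNReal.ofReal η := by
    rw [hlaw.measure_eq (p := (· ∈ bad)) hbad, Set.ofPred_mem_eq, Measure.prod_apply hbad,
      lintegral_map' (measurable_measure_prodMk_left hbad).aemeasurable hMm]
    exact (lintegral_mono_ae hfix).trans (by simp)
  have hreal : μ.real {ω | (N ω, fun i => X i ω) ∈ bad} ≤ η :=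
    ENNReal.toReal_le_of_le_ofReal hη.le hprob
  refine sub_le_iff_le_add.2 (le_trans ?_ (add_le_add_right hreal _))
  refine (probReal_univ (μ := μ)).ge.trans ((measureReal_mono fun ω _ => ?_).trans
    (measureReal_union_le _ _))
  exact le_or_gt ‖sensingError (fun i => X i ω) (M ω)‖ (δ * ‖M ω‖)
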